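/- Conventions. A standard complex Gaussian variable is one with the law of $(x+\mathrm{i}y)/\sqrt2$, where $x,y$ are independent real $\mathcal N(0,1)$ variables. Let $$h_k(t)=\frac{(-1)^k}{\sqrt{\sqrt{\pi}\,2^k k!}}\,e^{t^2/2}\,\frac{\mathrm d^k}{\mathrm dt^k}e^{-t^2},\qquad k\in\mathbb N,$$ be the Hermite functions, a Hilbert basis of $L^2(\mathbb R)$, and let $\mathfrak G$ be the completion of $L^2(\mathbb R)$ for the norm $\|s\|_{\mathfrak G}^2=\sum_{k\ge 0}|\langle s,h_k\rangle|^2/(1+k^2)$. Let $g(t)=\pi^{-1/4}e^{-t^2/2}$ be the (unit energy) circular Gaussian window and, for $s\in L^2(\mathbb R)$, $$\mathcal V_g s(t,\omega)=\int_{\mathbb R}s(u)\,\overline{g(u-t)}\,e^{-\mathrm{i}\omega u}\,\mathrm du .$$ Identify the time-frequency plane with $\mathbb C$ through $z=\omega+\mathrm{i}t$, and equip the space $C(\mathbb C)$ of continuous functions $\mathbb C\to\mathbb C$ with the topology of uniform convergence on compact sets. For $\gamma>0$ and i.i.d. standard complex Gaussian variables $(\eta_k)_{k\ge0}$, the planar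 Gaussian Analytic Function of parameter $\gamma$ is $\mathsf{GAF}_{\mathbb C}^{(\gamma)}(z)=\sum_{k\ge0}\eta_k\sqrt{\gamma^k/k!}\;z^k$. Proposition. Let $(\xi_k)_{k\ge0}$ be i.i.d. standard complex Gaussian variables. 1. The series $\xi=\sum_{k\ge0}\xi_kh_k$ (white noise) converges almost surely in $\mathfrak G$; the map $s\mapsto\big(z\mapsto\mathcal V_gs(t,\omega)\big)$ extends to a continuous map from $\mathfrak G$ to $C(\mathbb C)$, which defines $\mathcal V_g\xi$; and the series defining $\mathsf{GAF}_{\mathbb C}^{(1/2)}$ almost surely converges at every $z\in\mathbb C$ to an entire function. 2. The random function $z=\omega+\mathrm{i}t\mapsto\mathcal V_g\xi(t,\omega)$ has the same distribution, on $C(\mathbb C)$ with its Borel $\sigma$-algebra, as $$z\mapsto\psi(z)\,\mathsf{GAF}_{\mathbb C}^{(1/2)}(z),\qquad \psi(z)=\exp\!\Big(-\frac{|z|^2}{4}-\frac{\mathrm{i}\omega t}{2}\Big),$$ and the deterministic function $\psi$ vanishes nowhere. 3. Consequently the zeros of the Gaussian spectrogram $|\mathcal V_g\xi|^2$ of white noise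 are exactly the zeros of a planar Gaussian Analytic Function: there are i.i.d. standard complex Gaussian variables $(\zeta_k)_{k\ge0}$, on the same probability space as $\xi$, such that, almost surely, for all $z=\omega+\mathrm{i}t\in\mathbb C$, $\mathcal V_g\xi(t,\omega)=\psi(z)\sum_{k\ge0}\zeta_k\sqrt{2^{-k}/k!}\;z^k$, so that the zero set of the spectrogram coincides almost surely with the zero set of this planar Gaussian Analytic Function. In particular the zeros of the spectrogram and the zeros of any $\mathsf{GAF}_{\mathbb C}^{(1/2)}$ have the same law as point processes. -/

import Mathlib

open MeasureTheory ProbabilityTheory Filter Topology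
open scoped ComplexConjugate Nat

noncomputable section

namespace WhiteNoise

/-- The Hermite function of order `k`. -/
def hermiteFun (k : ℕ) (t : ℝ) : ℝ :=
  (-1) ^ k / √(√Real.pi * 2 ^ k * (k ! : ℝ)) * Real.exp (t ^ 2 / 2)
    * iteratedDeriv k (fun x : ℝ => Real.exp (-x ^ 2)) t

/-- The polynomial factor of the `k`-th Hermite function (auxiliary). -/
def hermPoly : ℕ → Polynomial ℝ
  | 0 => 1
  | n + 1 => 2 * Polynomial.X * hermPoly n - Polynomial.derivative (hermPoly n)

lemma hermPoly_derivative (n : ℕ) :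
    Polynomial.derivative (hermPoly (n + 1)) = (2 * (n + 1) : ℕ) * hermPoly n := by
  induction n with
  | zero => simp [hermPoly]
  | succ n ih =>
    have h2 : hermPoly (n + 1) = 2 * Polynomial.X * hermPoly n - Polynomial.derivative (hermPoly n) := rfl
    have h : hermPoly (n + 2) = 2 * Polynomial.X * hermPoly (n + 1)
      - Polynomial.derivative (hermPoly (n + 1)) := rfl
    rw [h, ih]
    simp only [Polynomial.derivative_sub, Polynomial.derivative_mul, Polynomial.derivative_X,
      Polynomial.derivative_natCast, ih]
    simp only [Polynomial.derivative_ofNat]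
    rw [h2]
    push_cast
    ring

lemma hasDerivAt_gauss (p : Polynomial ℝ) (x : ℝ) :
    HasDerivAt (fun x : ℝ => p.eval x * Real.exp (-x ^ 2))
      (-((2 * Polynomial.X * p - Polynomial.derivative p).eval x * Real.exp (-x ^ 2))) x := by
  have h1 : HasDerivAt (fun x : ℝ => Real.exp (-x ^ 2)) (Real.exp (-x ^ 2) * (-(2 * x))) x := by
    have : HasDerivAt (fun x : ℝ => -x ^ 2) (-(2 * x)) x := by
      simpa using! (hasDerivAt_pow 2 x).neg
    exact this.exp
  have := (p.hasDerivAt x).mul h1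
  convert! this using 1
  simp
  ring

lemma iteratedDeriv_gauss (n : ℕ) :
    iteratedDeriv n (fun x : ℝ => Real.exp (-x ^ 2))
      = fun x => (-1) ^ n * ((hermPoly n).eval x * Real.exp (-x ^ 2)) := by
  induction n with
  | zero => ext x; simp [hermPoly]
  | succ n ih =>
    rw [iteratedDeriv_succ, ih]
    ext x
    rw [((hasDerivAt_gauss (hermPoly n) x).const_mul _).deriv, hermPoly, pow_succ]
    ring

lemma hermiteFun_eq (k : ℕ) (t : ℝ) :
    hermiteFun k t = (√(√Real.pi * 2 ^ k * (k ! : ℝ)))⁻¹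
      * ((hermPoly k).eval t * Real.exp (-(1 / 2) * t ^ 2)) := by
  rw [hermiteFun, iteratedDeriv_gauss]
  have h1 : Real.exp (-(1 / 2) * t ^ 2) = Real.exp (t ^ 2 / 2) * Real.exp (-t ^ 2) := by
    rw [← Real.exp_add]; ring_nf
  have h2 : ((-1 : ℝ) ^ k) * (-1) ^ k = 1 := by rw [← mul_pow]; simp
  rw [h1]
  linear_combination (√(√Real.pi * 2 ^ k * (k ! : ℝ)))⁻¹ * (Real.exp (t ^ 2 / 2)) *
    ((hermPoly k).eval t * Real.exp (-t ^ 2)) * h2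

lemma integrable_poly_gauss (p : Polynomial ℝ) {b : ℝ} (hb : 0 < b) :
    Integrable (fun x : ℝ => p.eval x * Real.exp (-b * x ^ 2)) := by
  induction p using Polynomial.induction_on' with
  | add p q hp hq => simpa [add_mul] using! hp.add hq
  | monomial n a =>
    have := (integrable_rpow_mul_exp_neg_mul_sq hb (s := n)
      (by have : (0 : ℝ) ≤ n := Nat.cast_nonneg n
          linarith)).const_mul a
    simpa [mul_assoc] using this

lemma integrable_poly_gauss_one (p : Polynomial ℝ) :
    Integrable (fun x : ℝ => p.eval x * Real.exp (-x ^ 2)) := by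
  simpa using integrable_poly_gauss p one_pos

lemma integral_hermPoly_succ (p : Polynomial ℝ) (n : ℕ) :
    ∫ x : ℝ, p.eval x * ((hermPoly (n + 1)).eval x * Real.exp (-x ^ 2))
      = ∫ x : ℝ, (Polynomial.derivative p).eval x * ((hermPoly n).eval x * Real.exp (-x ^ 2)) := by
  have key (q r : Polynomial ℝ) :
      Integrable (fun x : ℝ => q.eval x * (r.eval x * Real.exp (-x ^ 2))) := by
    simpa [mul_assoc] using integrable_poly_gauss_one (q * r)
  have := integral_mul_deriv_eq_deriv_mul_of_integrable
    (u := fun x => p.eval x) (u' := fun x => (Polynomial.derivative p).eval x)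
    (v := fun x => (hermPoly n).eval x * Real.exp (-x ^ 2))
    (v' := fun x => -((hermPoly (n + 1)).eval x * Real.exp (-x ^ 2)))
    (fun x _ => p.hasDerivAt x) (fun x _ => hasDerivAt_gauss (hermPoly n) x)
    (by simpa [Pi.mul_def] using (key p (hermPoly (n + 1))).neg)
    (key _ _) (key _ _)
  simp only [mul_neg, integral_neg, neg_inj] at this
  exact this

lemma integral_hermPoly_mul (m n : ℕ) :
    ∫ x : ℝ, (hermPoly m).eval x * ((hermPoly n).eval x * Real.exp (-x ^ 2))
      = if m = n then √Real.pi * 2 ^ n * (n ! : ℝ) else 0 := by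
  induction n generalizing m with
  | zero =>
    cases m with
    | zero =>
      have := integral_gaussian 1
      simpa [hermPoly] using this
    | succ m =>
      have := integral_hermPoly_succ 1 m
      simp only [Polynomial.eval_one, one_mul, Polynomial.derivative_one, Polynomial.eval_zero,
        zero_mul, integral_zero] at this
      simpa [hermPoly] using this
  | succ n ih =>
    rw [integral_hermPoly_succ]
    cases m with
    | zero => simp [hermPoly]
    | succ m =>
      have h (x : ℝ) : (Polynomial.derivative (hermPoly (m + 1))).eval x
          * ((hermPoly n).eval x * Real.exp (-x ^ 2))
          = (2 * ((m : ℝ) + 1)) * ((hermPoly m).eval x * ((hermPoly n).eval x * Real.exp (-x ^ 2))) := by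
        rw [hermPoly_derivative]
        simp only [Polynomial.eval_mul, Polynomial.eval_natCast]
        push_cast
        ring
      simp_rw [h]
      rw [integral_const_mul, ih]
      by_cases hmn : m = n
      · subst hmn
        simp only [if_true, Nat.factorial_succ]
        push_cast
        ring
      · simp [hmn]

lemma continuous_hermiteFun (k : ℕ) : Continuous (hermiteFun k) := by
  rw [funext (hermiteFun_eq k)]
  fun_prop

lemma hermiteFun_mul (m n : ℕ) (t : ℝ) :
    hermiteFun m t * hermiteFun n t = (√(√Real.pi * 2 ^ m * (m ! : ℝ)))⁻¹
      * (√(√Real.pi * 2 ^ n * (n ! : ℝ)))⁻¹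
      * ((hermPoly m).eval t * ((hermPoly n).eval t * Real.exp (-t ^ 2))) := by
  have h1 : Real.exp (-t ^ 2) = Real.exp (-(1 / 2) * t ^ 2) * Real.exp (-(1 / 2) * t ^ 2) := by
    rw [← Real.exp_add]; ring_nf
  rw [hermiteFun_eq, hermiteFun_eq, h1]
  ring

lemma integrable_hermiteFun_mul (m n : ℕ) :
    Integrable (fun t => hermiteFun m t * hermiteFun n t) := by
  simp_rw [hermiteFun_mul]
  apply Integrable.const_mul
  simpa [mul_assoc] using integrable_poly_gauss_one (hermPoly m * hermPoly n)

lemma integral_hermiteFun_mul (m n : ℕ) :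
    ∫ t, hermiteFun m t * hermiteFun n t = if m = n then 1 else 0 := by
  simp_rw [hermiteFun_mul]
  rw [integral_const_mul, integral_hermPoly_mul]
  by_cases h : m = n
  · subst h
    have hp : 0 < √Real.pi * 2 ^ m * (m ! : ℝ) := by positivity
    simp only [if_true]
    rw [← mul_inv, Real.mul_self_sqrt hp.le]
    exact inv_mul_cancel₀ hp.ne'
  · simp [h]

lemma memLp_hermiteFun (k : ℕ) :
    MemLp (fun t : ℝ => (hermiteFun k t : ℂ)) 2 volume := by
  have : MemLp (hermiteFun k) 2 volume := by
    rw [memLp_two_iff_integrable_sq (continuous_hermiteFun k).aestronglyMeasurable]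
    simpa [sq] using integrable_hermiteFun_mul k k
  exact this.ofReal

/-- The Hilbert space `L²(ℝ)` of finite-energy complex signals. -/
abbrev Signal : Type := Lp ℂ 2 (volume : Measure ℝ)

/-- The Hermite function of order `k` as an element of `L²(ℝ)`. -/
def hermiteSignal (k : ℕ) : Signal := (memLp_hermiteFun k).toLp _

lemma inner_hermiteSignal (k : ℕ) (s : Signal) :
    inner ℂ (hermiteSignal k) s = ∫ t, (hermiteFun k t : ℂ) * s t := by
  rw [L2.inner_def]
  apply integral_congr_ae
  filter_upwards [(memLp_hermiteFun k).coeFn_toLp] with t ht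
  rw [hermiteSignal, ht]
  simp [mul_comm]

lemma orthonormal_hermiteSignal : Orthonormal ℂ hermiteSignal := by
  rw [orthonormal_iff_ite]
  intro m n
  rw [inner_hermiteSignal]
  have : ∫ t, (hermiteFun m t : ℂ) * (hermiteSignal n) t
      = ∫ t, ((hermiteFun m t * hermiteFun n t : ℝ) : ℂ) := by
    apply integral_congr_ae
    filter_upwards [(memLp_hermiteFun n).coeFn_toLp] with t ht
    rw [hermiteSignal, ht]
    simp
  rw [this, integral_complex_ofReal, integral_hermiteFun_mul]
  split_ifs <;> simp


lemma memLp_of_sq {f : ℝ → ℝ} (hf : Continuous f) (h : Integrable (fun x => f x ^ 2)) :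
    MemLp (fun x => (f x : ℂ)) 2 volume :=
  ((memLp_two_iff_integrable_sq hf.aestronglyMeasurable).2 h).ofReal

lemma integrable_mul_signal {f : ℝ → ℂ} (hf : MemLp f 2 volume) (s : Signal) :
    Integrable (fun x => f x * s x) :=
  hf.integrable_mul (Lp.memLp s)

lemma memLp_poly_gauss (p : Polynomial ℝ) :
    MemLp (fun x : ℝ => ((p.eval x * Real.exp (-(1 / 2) * x ^ 2) : ℝ) : ℂ)) 2 volume := by
  refine memLp_of_sq (by fun_prop) ?_
  refine (integrable_poly_gauss_one (p ^ 2)).congr (ae_of_all _ fun x => ?_)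
  have h1 : Real.exp (-x ^ 2) = Real.exp (-(1 / 2) * x ^ 2) * Real.exp (-(1 / 2) * x ^ 2) := by
    rw [← Real.exp_add]; ring_nf
  simp only [Polynomial.eval_pow, h1]
  ring

/-- The pairing of a signal with a polynomial times a Gaussian (auxiliary). -/
def polyPairing (s : Signal) : Polynomial ℝ →ₗ[ℝ] ℂ where
  toFun p := ∫ x : ℝ, ((p.eval x * Real.exp (-(1 / 2) * x ^ 2) : ℝ) : ℂ) * s x
  map_add' p q := by
    rw [← integral_add (integrable_mul_signal (memLp_poly_gauss p) s)
      (integrable_mul_signal (memLp_poly_gauss q) s)]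
    congr 1
    ext x
    simp only [Polynomial.eval_add]
    push_cast
    ring
  map_smul' c p := by
    rw [RingHom.id_apply, ← integral_smul]
    congr 1
    ext x
    simp only [Polynomial.eval_smul, smul_eq_mul, Complex.real_smul]
    push_cast
    ring

lemma polyPairing_eq_zero {s : Signal} (hs : ∀ k, inner ℂ (hermiteSignal k) s = 0) (k n : ℕ) :
    polyPairing s (Polynomial.X ^ k * hermPoly n) = 0 := by
  induction k generalizing n with
  | zero =>
    have h := hs n
    rw [inner_hermiteSignal] at h
    simp_rw [hermiteFun_eq, Complex.ofReal_mul, mul_assoc] at h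
    rw [integral_const_mul] at h
    have hp : 0 < √(√Real.pi * (2 ^ n * (n ! : ℝ))) := by positivity
    have h' := (mul_eq_zero.1 h).resolve_left (by
      refine Complex.ofReal_ne_zero.2 ?_
      exact (inv_pos.2 hp).ne')
    simpa [polyPairing, mul_assoc] using h'
  | succ k ih =>
    have hX : Polynomial.X ^ (k + 1) * hermPoly n = (1 / 2 : ℝ) • (Polynomial.X ^ k * hermPoly (n + 1))
        + (1 / 2 : ℝ) • (Polynomial.X ^ k * Polynomial.derivative (hermPoly n)) := by
      have h : hermPoly (n + 1)
        = 2 * Polynomial.X * hermPoly n - Polynomial.derivative (hermPoly n) := rfl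
      rw [← smul_add, h, Polynomial.smul_eq_C_mul]
      have h2 : Polynomial.C (1 / 2 : ℝ) * 2 = 1 := by
        rw [← Polynomial.C_ofNat, ← Polynomial.C_mul]; norm_num
      linear_combination (-(Polynomial.X ^ (k + 1) * hermPoly n)) * h2
    rw [hX, map_add, map_smul, map_smul, ih]
    cases n with
    | zero => simp [hermPoly]
    | succ n =>
      rw [hermPoly_derivative]
      have : Polynomial.X ^ k * (((2 * (n + 1) : ℕ) : Polynomial ℝ) * hermPoly n)
          = ((2 * (n + 1) : ℕ) : ℝ) • (Polynomial.X ^ k * hermPoly n) := by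
        rw [Polynomial.smul_eq_C_mul]
        simp only [Polynomial.C_eq_natCast]
        ring
      rw [this, map_smul, ih]
      simp

lemma memLp_exp_gauss (a : ℝ) :
    MemLp (fun x : ℝ => ((Real.exp (a * |x|) * Real.exp (-(1 / 2) * x ^ 2) : ℝ) : ℂ)) 2 volume := by
  refine memLp_of_sq (by fun_prop) ?_
  have hI : Integrable (fun x : ℝ => Real.exp (2 * a ^ 2) * Real.exp (-(1 / 2) * x ^ 2)) :=
    (integrable_exp_neg_mul_sq (by norm_num)).const_mul _
  refine hI.mono' (by fun_prop) (ae_of_all _ fun x => ?_)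
  rw [Real.norm_of_nonneg (by positivity), ← Real.exp_add, ← Real.exp_add, ← Real.exp_nat_mul]
  apply Real.exp_le_exp.2
  push_cast
  nlinarith [sq_nonneg (2 * a - |x|), sq_abs x]

lemma integral_cexp_eq_zero {s : Signal} (hs : ∀ k, inner ℂ (hermiteSignal k) s = 0) (c : ℂ) :
    ∫ x : ℝ, Complex.exp (c * x) * ((Real.exp (-(1 / 2) * x ^ 2) : ℝ) * s x) = 0 := by
  have h0 (k : ℕ) :
      ∫ x : ℝ, (c * x) ^ k / (k ! : ℂ) * ((Real.exp (-(1 / 2) * x ^ 2) : ℝ) * s x) = 0 := by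
    have h := polyPairing_eq_zero hs k 0
    have h' : ∫ x : ℝ, (c ^ k / (k ! : ℂ)) *
      (((x ^ k * Real.exp (-(1 / 2) * x ^ 2) : ℝ) : ℂ) * s x) = 0 := by
      rw [integral_const_mul]
      simp only [polyPairing, hermPoly, mul_one, LinearMap.coe_mk, AddHom.coe_mk,
        Polynomial.eval_pow, Polynomial.eval_X] at h
      rw [h, mul_zero]
    rw [← h']
    congr 1
    ext x
    push_cast
    ring
  have hsum := hasSum_integral_of_dominated_convergence (μ := volume)
    (F := fun (k : ℕ) (x : ℝ) =>
      (c * x) ^ k / (k ! : ℂ) * ((Real.exp (-(1 / 2) * x ^ 2) : ℝ) * s x))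
    (f := fun x : ℝ => Complex.exp (c * x) * ((Real.exp (-(1 / 2) * x ^ 2) : ℝ) * s x))
    (bound := fun (k : ℕ) (x : ℝ) =>
      (‖c‖ * |x|) ^ k / (k ! : ℝ) * ‖((Real.exp (-(1 / 2) * x ^ 2) : ℝ) : ℂ) * s x‖)
    (fun k => by
      have : AEStronglyMeasurable (fun x => s x) (volume : Measure ℝ) :=
        (Lp.memLp s).aestronglyMeasurable
      fun_prop)
    (fun k => ae_of_all _ fun x => by simp)
    (ae_of_all _ fun x => (Real.summable_pow_div_factorial _).mul_right _)
    (by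
      have h := (integrable_mul_signal (memLp_exp_gauss ‖c‖) s).norm
      refine h.congr (ae_of_all _ fun x => ?_)
      simp only
      rw [tsum_mul_right]
      have : ∑' k : ℕ, (‖c‖ * |x|) ^ k / (k ! : ℝ) = Real.exp (‖c‖ * |x|) := by
        rw [Real.exp_eq_exp_ℝ, NormedSpace.exp_eq_tsum_div]
      rw [this]
      rw [Complex.ofReal_mul, mul_assoc, norm_mul, Complex.norm_real,
        Real.norm_of_nonneg (Real.exp_pos _).le])
    (ae_of_all _ fun x => by
      refine HasSum.mul_right _ ?_
      rw [Complex.exp_eq_exp_ℂ]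
      exact NormedSpace.expSeries_div_hasSum_exp (c * x))
  simp_rw [h0] at hsum
  exact hsum.unique hasSum_zero

lemma signal_eq_zero {s : Signal} (hs : ∀ k, inner ℂ (hermiteSignal k) s = 0) : s = 0 := by
  set G : ℝ → ℂ := fun x => ((Real.exp (-(1 / 2) * x ^ 2) : ℝ) : ℂ) * s x with hG
  have hGi : Integrable G := by
    have := integrable_mul_signal (memLp_poly_gauss 1) s
    simpa [hG] using this
  have hF : FourierTransform.fourier G = 0 := by
    ext ξ
    rw [Real.fourier_eq']
    have := integral_cexp_eq_zero hs (-2 * Real.pi * ξ * Complex.I)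
    simp only [Pi.zero_apply]
    rw [← this]
    congr 1
    ext x
    simp only [smul_eq_mul, hG]
    congr 2
    simp
    ring
  have hz : ∀ᵐ x : ℝ, G x = 0 := by
    refine ae_eq_zero_of_integral_contDiff_smul_eq_zero hGi.locallyIntegrable fun g hg hgc => ?_
    have hg₁ : HasCompactSupport (Complex.ofRealCLM ∘ g) := hgc.comp_left rfl
    have hg₂ : ContDiff ℝ ((⊤ : ℕ∞) : WithTop ℕ∞) (Complex.ofRealCLM ∘ g) :=
      Complex.ofRealCLM.contDiff.comp hg
    set f₁ : SchwartzMap ℝ ℂ := hg₁.toSchwartzMap hg₂ with hf₁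
    set ψ : SchwartzMap ℝ ℂ := FourierTransformInv.fourierInv f₁ with hψ
    have h1 : FourierTransform.fourier ψ = f₁ := by simp [hψ]
    have h2 : (FourierTransform.fourier (ψ : ℝ → ℂ)) = f₁ := by
      rw [← SchwartzMap.fourier_coe, h1]
    have h3 := VectorFourier.integral_fourierIntegral_smul_eq_flip (L := innerₗ ℝ)
      Real.continuous_fourierChar continuous_inner ψ.integrable hGi (μ := volume) (ν := volume)
    have h4 : ∫ ξ : ℝ, (FourierTransform.fourier (ψ : ℝ → ℂ)) ξ • G ξ
        = ∫ x : ℝ, ψ x • FourierTransform.fourier G x := by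
      simpa [flip_innerₗ] using! h3
    rw [h2, hF] at h4
    simp only [Pi.zero_apply, smul_zero, integral_zero] at h4
    rw [← h4]
    congr 1
  rw [Lp.eq_zero_iff_ae_eq_zero]
  filter_upwards [hz] with x hx
  simpa [hG] using hx

/-- The Hilbert basis of `L²(ℝ)` formed by the Hermite functions. -/
def hermiteBasis : HilbertBasis ℕ ℂ Signal :=
  HilbertBasis.mkOfOrthogonalEqBot orthonormal_hermiteSignal (by
    rw [Submodule.eq_bot_iff]
    intro s hs
    refine signal_eq_zero fun k => ?_
    exact (Submodule.mem_orthogonal _ _).1 hs _ (Submodule.subset_span ⟨k, rfl⟩))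

lemma hermiteBasis_apply (k : ℕ) : hermiteBasis k = hermiteSignal k := by
  simp [hermiteBasis]

section WeakNorm

variable {H : Type*} [NormedAddCommGroup H] [InnerProductSpace ℂ H]

/-- A copy of the Hilbert space `H`, to carry the weak norm attached to the Hilbert basis `b`. -/
def Weakened (_b : HilbertBasis ℕ ℂ H) : Type _ := H

instance (b : HilbertBasis ℕ ℂ H) : AddCommGroup (Weakened b) := inferInstanceAs (AddCommGroup H)

instance (b : HilbertBasis ℕ ℂ H) : Module ℂ (Weakened b) := inferInstanceAs (Module ℂ H)

/-- The identity map from `H` to its copy. -/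
def toWeak (b : HilbertBasis ℕ ℂ H) : H ≃ₗ[ℂ] Weakened b := LinearEquiv.refl ℂ H

/-- The weak norm `‖s‖² = ∑ₖ |⟨s, bₖ⟩|² / (1 + k²)`. -/
instance (b : HilbertBasis ℕ ℂ H) : Norm (Weakened b) :=
  ⟨fun s => √(∑' k : ℕ, ‖inner ℂ (b k) ((toWeak b).symm s)‖ ^ 2 / (1 + (k : ℝ) ^ 2))⟩

lemma weak_norm_def (b : HilbertBasis ℕ ℂ H) (s : Weakened b) :
    ‖s‖ = √(∑' k : ℕ, ‖inner ℂ (b k) ((toWeak b).symm s)‖ ^ 2 / (1 + (k : ℝ) ^ 2)) := rfl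

lemma norm_weight_sq (c : ℂ) (k : ℕ) :
    ‖c / (√(1 + (k : ℝ) ^ 2) : ℝ)‖ ^ 2 = ‖c‖ ^ 2 / (1 + (k : ℝ) ^ 2) := by
  rw [norm_div, div_pow, Complex.norm_real, Real.norm_of_nonneg (Real.sqrt_nonneg _),
    Real.sq_sqrt (by positivity)]

lemma summable_weak (b : HilbertBasis ℕ ℂ H) (s : H) :
    Summable (fun k : ℕ => ‖inner ℂ (b k) s‖ ^ 2 / (1 + (k : ℝ) ^ 2)) := by
  have h : Summable (fun k : ℕ => ‖inner ℂ (b k) s‖ ^ 2) := b.orthonormal.inner_products_summable s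
  refine h.of_nonneg_of_le (fun k => by positivity) fun k => div_le_self (by positivity) ?_
  nlinarith [sq_nonneg (k : ℝ)]

/-- The weighted coefficient sequence of a vector (auxiliary). -/
def weakSeq (b : HilbertBasis ℕ ℂ H) (s : Weakened b) : lp (fun _ : ℕ => ℂ) 2 :=
  ⟨fun k => inner ℂ (b k) ((toWeak b).symm s) / (√(1 + (k : ℝ) ^ 2) : ℝ), by
    refine memℓp_gen ?_
    simp only [ENNReal.toReal_ofNat, Real.rpow_ofNat, norm_weight_sq]
    exact summable_weak b _⟩

lemma norm_weakSeq (b : HilbertBasis ℕ ℂ H) (s : Weakened b) : ‖weakSeq b s‖ = ‖s‖ := by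
  rw [lp.norm_eq_tsum_rpow (by norm_num), weak_norm_def, Real.sqrt_eq_rpow]
  simp only [ENNReal.toReal_ofNat, Real.rpow_ofNat, weakSeq, norm_weight_sq]

lemma weak_core (b : HilbertBasis ℕ ℂ H) : NormedSpace.Core ℂ (Weakened b) where
  norm_nonneg s := Real.sqrt_nonneg _
  norm_smul c s := by
    rw [← norm_weakSeq, ← norm_weakSeq, ← norm_smul]
    congr 1
    ext k
    simp [weakSeq, mul_div_assoc]
  norm_triangle s t := by
    rw [← norm_weakSeq, ← norm_weakSeq, ← norm_weakSeq]
    have : weakSeq b (s + t) = weakSeq b s + weakSeq b t := by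
      ext k
      simp [weakSeq, add_div]
      rfl
    rw [this]
    exact norm_add_le _ _
  norm_eq_zero_iff s := by
    rw [← norm_weakSeq, norm_eq_zero]
    constructor
    · intro h
      have hk (k : ℕ) : inner ℂ (b k) ((toWeak b).symm s) = 0 := by
        have h1 : (weakSeq b s) k = 0 := by rw [h]; rfl
        have h2 : (√(1 + (k : ℝ) ^ 2) : ℝ) ≠ 0 := by positivity
        simpa [weakSeq, h2] using! h1
      have h3 : b.repr ((toWeak b).symm s) = 0 := by
        ext k
        rw [b.repr_apply_apply, hk k]
        rfl
      exact (toWeak b).symm.map_eq_zero_iff.1 (b.repr.map_eq_zero_iff.1 h3)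
    · rintro rfl
      ext k
      simp [weakSeq]

instance (b : HilbertBasis ℕ ℂ H) : NormedAddCommGroup (Weakened b) :=
  NormedAddCommGroup.ofCore (weak_core b)

instance (b : HilbertBasis ℕ ℂ H) : NormedSpace ℂ (Weakened b) :=
  NormedSpace.ofCore (weak_core b)

/-- The completion of the Hilbert space for the weak norm: the space in which white noise lives. -/
abbrev NoiseSpace (b : HilbertBasis ℕ ℂ H) : Type _ := UniformSpace.Completion (Weakened b)

/-- The truncated white noise `∑_{k < n} aₖ bₖ` with coefficients `a`. -/
def truncatedNoise (b : HilbertBasis ℕ ℂ H) (a : ℕ → ℂ) (n : ℕ) : NoiseSpace b :=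
  (toWeak b (∑ k ∈ Finset.range n, a k • b k) : Weakened b)

/-- The sum of the series `∑ₖ aₖ bₖ` in the completed space. It is white noise associated with the
Hilbert basis `b` when the `aₖ` are i.i.d. standard complex Gaussian variables. -/
def whiteNoise (b : HilbertBasis ℕ ℂ H) (a : ℕ → ℂ) : NoiseSpace b :=
  limUnder atTop (truncatedNoise b a)

end WeakNorm

/-- The standard complex Gaussian distribution: the law of `(x + i y) / √2` for independent real
standard Gaussian variables `x` and `y`. -/
def stdComplexGaussian : Measure ℂ :=
  ((gaussianReal 0 1).prod (gaussianReal 0 1)).map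
    (fun p : ℝ × ℝ => ((p.1 : ℂ) + Complex.I * p.2) / (√2 : ℝ))

/-- `ξ` is a sequence of i.i.d. standard complex Gaussian variables. -/
structure IsStdComplexGaussianSeq {Ω : Type*} [MeasurableSpace Ω] (ξ : ℕ → Ω → ℂ)
    (P : Measure Ω) : Prop where
  hasLaw : ∀ k, HasLaw (ξ k) stdComplexGaussian P
  indep : iIndepFun ξ P

/-- The Short-Time Fourier Transform with window `h` of the signal `s`, at time `t` and angular
frequency `ω`. -/
def stft (h s : ℝ → ℂ) (t ω : ℝ) : ℂ :=
  ∫ u : ℝ, s u * conj (h (u - t)) * Complex.exp (-(Complex.I * ω * u))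

/-- The (unit energy) circular Gaussian window. -/
def gaussWindow (t : ℝ) : ℂ := (Real.pi ^ (-(1 / 4) : ℝ) * Real.exp (-t ^ 2 / 2) : ℝ)

lemma continuous_stft_gaussWindow (s : Signal) :
    Continuous (fun z : ℂ => stft gaussWindow s z.im z.re) := by
  rw [continuous_iff_continuousAt]
  intro z₀
  set M : ℝ := |z₀.im| + 1 with hM
  have hmeas : AEStronglyMeasurable (fun x => s x) (volume : Measure ℝ) :=
    (Lp.memLp s).aestronglyMeasurable
  have hw : Continuous gaussWindow := by unfold gaussWindow; fun_prop
  have hb : MemLp (fun u : ℝ => ((Real.exp (-(1 / 4) * u ^ 2) : ℝ) : ℂ)) 2 volume := by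
    refine memLp_of_sq (by fun_prop) ?_
    refine (integrable_exp_neg_mul_sq (b := 1 / 2) (by norm_num)).congr (ae_of_all _ fun u => ?_)
    simp only [sq (Real.exp _), ← Real.exp_add]
    ring_nf
  refine continuousAt_of_dominated
    (bound := fun u => (Real.pi ^ (-(1 / 4) : ℝ) * Real.exp (M ^ 2 / 2)) *
      ‖((Real.exp (-(1 / 4) * u ^ 2) : ℝ) : ℂ) * s u‖)
    (Eventually.of_forall fun z => by fun_prop) ?_
    ((integrable_mul_signal hb s).norm.const_mul _)
    (ae_of_all _ fun u => by fun_prop)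
  have hball : ∀ᶠ z : ℂ in 𝓝 z₀, |z.im| < M := by
    have : ContinuousAt (fun z : ℂ => |z.im|) z₀ := by fun_prop
    exact this.eventually_lt continuousAt_const (by simp [hM])
  filter_upwards [hball] with z hz
  refine ae_of_all _ fun u => ?_
  have hexp : ‖Complex.exp (-(Complex.I * z.re * u))‖ = 1 := by
    rw [Complex.norm_exp]; simp
  have hle : Real.exp (-(u - z.im) ^ 2 / 2)
      ≤ Real.exp (M ^ 2 / 2) * Real.exp (-(1 / 4) * u ^ 2) := by
    rw [← Real.exp_add]
    apply Real.exp_le_exp.2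
    have : z.im ^ 2 ≤ M ^ 2 := by
      rw [← sq_abs z.im]
      exact pow_le_pow_left₀ (abs_nonneg _) hz.le 2
    nlinarith [sq_nonneg (u - 2 * z.im)]
  rw [norm_mul, norm_mul, norm_mul, hexp, mul_one, RCLike.norm_conj, gaussWindow,
    Complex.norm_real, Complex.norm_real, Real.norm_of_nonneg (by positivity),
    Real.norm_of_nonneg (Real.exp_pos _).le]
  have hpi : 0 ≤ Real.pi ^ (-(1 / 4) : ℝ) := by positivity
  calc ‖s u‖ * (Real.pi ^ (-(1 / 4) : ℝ) * Real.exp (-(u - z.im) ^ 2 / 2))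
      ≤ ‖s u‖ * (Real.pi ^ (-(1 / 4) : ℝ) *
        (Real.exp (M ^ 2 / 2) * Real.exp (-(1 / 4) * u ^ 2))) := by gcongr
    _ = _ := by ring

/-- The Short-Time Fourier Transform with circular Gaussian window of a finite-energy signal, as a
continuous function of `z = ω + i t`. -/
def gaussSTFT (s : Signal) : C(ℂ, ℂ) :=
  ⟨fun z => stft gaussWindow s z.im z.re, continuous_stft_gaussWindow s⟩

/-- The extension by continuity of the Gaussian Short-Time Fourier Transform to the space in which
white noise (for the Hermite basis) lives; the space of continuous functions on `ℂ` carries the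
topology of uniform convergence on compact sets. -/
def noiseSTFT : NoiseSpace hermiteBasis → C(ℂ, ℂ) :=
  UniformSpace.Completion.extension fun s => gaussSTFT ((toWeak hermiteBasis).symm s)

/-- The Borel σ-algebra of the topology of uniform convergence on compact sets. -/
instance : MeasurableSpace C(ℂ, ℂ) := borel _

instance : BorelSpace C(ℂ, ℂ) := ⟨rfl⟩

open Classical in
/-- The power series `∑ₖ aₖ √(γᵏ / k!) zᵏ` as a continuous function on `ℂ` (by convention `0` if it
is not one). For i.i.d. standard complex Gaussian coefficients it is, almost surely, an entire
function: the planar Gaussian Analytic Function of parameter `γ`. -/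
def planarGAF (γ : ℝ) (a : ℕ → ℂ) : C(ℂ, ℂ) :=
  if h : Continuous (fun z : ℂ => ∑' k : ℕ, a k * (√(γ ^ k / (k ! : ℝ)) : ℝ) * z ^ k)
  then ⟨_, h⟩ else 0

/-- The factor `z ↦ exp(-|z|²/4 - i ω t / 2)`, with `z = ω + i t`. -/
def stftFactor : C(ℂ, ℂ) :=
  ⟨fun z => Complex.exp (-((‖z‖ ^ 2 / 4 : ℝ) : ℂ) - Complex.I * z.re * z.im / 2), by fun_prop⟩

/-- The spectrogram: the squared modulus of the Short-Time Fourier Transform. -/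
def spectrogram (F : C(ℂ, ℂ)) (z : ℂ) : ℝ := ‖F z‖ ^ 2

/-- A point configuration, encoded by its counting measure. -/
def pointCount (Z : Set ℂ) : Measure ℂ := Measure.count.restrict Z

end WhiteNoise

end

open WhiteNoise

/-!
The Short-Time Fourier Transform at `z = ω + i t` is the inner product with the Gabor atom at `z`,
and that of the `k`-th Hermite function is `ψ(z) √(2⁻ᵏ / k!) (-i z)ᵏ`: up to constants it is the
integral of `exp(-i z u) Hₖ(u) exp(-u²)`, where `k` integrations by parts move the derivatives of
`exp(-u²)` onto the exponential. These coefficients decay faster than any power of `k`, locally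
uniformly in `z`, so the Cauchy-Schwarz inequality with weights `1 + k²` bounds the transform by the
weak norm on compact sets, and the transform extends to the completion. As
`∑ₖ E |ξₖ|² / (1 + k²) < ∞`, the white noise series converges almost surely, and by continuity its
transform is `ψ(z) ∑ₖ (-i)ᵏ ξₖ √(2⁻ᵏ / k!) zᵏ`. The law of the `ξₖ` is invariant under rotations, so
this sum is again a planar Gaussian Analytic Function. Finally, the point process of zeros is a
measurable function of a continuous function with locally finite zeros: a closed set `Z` has at
least `n` points if and only if it meets `n` pairwise disjoint sets of a given basis, and
meeting a `σ`-compact set is a Borel condition on the function whose zero set is `Z`.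
-/

noncomputable section

namespace WhiteNoise

section WeightedSequences

variable {ι : Type*} {w x y : ι → ℝ}

lemma summable_mul_of_summable_weighted_sq (hw : ∀ i, 0 < w i)
    (hx : Summable fun i => x i ^ 2 / w i) (hy : Summable fun i => w i * y i ^ 2) :
    Summable fun i => x i * y i := by
  refine .of_norm_bounded (hx.add hy) fun i => ?_
  have amgm (ε : ℝ) : 2 * (ε * (x i * y i)) ≤ x i ^ 2 / w i * ε ^ 2 + w i * y i ^ 2 := by
    have hsq : x i ^ 2 / w i * ε ^ 2 + w i * y i ^ 2 - 2 * (ε * (x i * y i))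
        = (x i * ε - w i * y i) ^ 2 / w i := by
      have := (hw i).ne'
      field_simp
      ring
    linarith [div_nonneg (sq_nonneg (x i * ε - w i * y i)) (hw i).le]
  have hx0 : 0 ≤ x i ^ 2 / w i := div_nonneg (sq_nonneg _) (hw i).le
  have hy0 : 0 ≤ w i * y i ^ 2 := mul_nonneg (hw i).le (sq_nonneg _)
  rw [Real.norm_eq_abs, abs_le']
  constructor
  · linarith [amgm 1]
  · linarith [amgm (-1)]

lemma tsum_mul_le_sqrt_mul_sqrt_weighted (hw : ∀ i, 0 < w i)
    (hx : Summable fun i => x i ^ 2 / w i) (hy : Summable fun i => w i * y i ^ 2) :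
    ∑' i, x i * y i ≤ √(∑' i, x i ^ 2 / w i) * √(∑' i, w i * y i ^ 2) := by
  refine (summable_mul_of_summable_weighted_sq hw hx hy).tsum_le_of_sum_le fun s => ?_
  have hfactor (i : ι) : x i * y i = (x i / √(w i)) * (√(w i) * y i) := by
    have := (Real.sqrt_pos.2 (hw i)).ne'
    field_simp
  calc ∑ i ∈ s, x i * y i = ∑ i ∈ s, (x i / √(w i)) * (√(w i) * y i) := by simp_rw [← hfactor]
    _ ≤ √(∑ i ∈ s, (x i / √(w i)) ^ 2) * √(∑ i ∈ s, (√(w i) * y i) ^ 2) :=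
      Real.sum_mul_le_sqrt_mul_sqrt _ _ _
    _ = √(∑ i ∈ s, x i ^ 2 / w i) * √(∑ i ∈ s, w i * y i ^ 2) := by
      simp_rw [div_pow, mul_pow, Real.sq_sqrt (hw _).le]
    _ ≤ _ := by
      gcongr
      · exact hx.sum_le_tsum _ fun i _ => div_nonneg (sq_nonneg _) (hw i).le
      · exact hy.sum_le_tsum _ fun i _ => mul_nonneg (hw i).le (sq_nonneg _)

end WeightedSequences

lemma one_add_natCast_sq_pos (k : ℕ) : 0 < 1 + (k : ℝ) ^ 2 := by positivity

section PlanarGAF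

variable {γ : ℝ} {a : ℕ → ℂ}

/-- The `k`-th term of the power series defining `planarGAF γ a`, as a continuous function. -/
def gafTerm (γ : ℝ) (a : ℕ → ℂ) (k : ℕ) : C(ℂ, ℂ) :=
  ⟨fun z => a k * (√(γ ^ k / (k ! : ℝ)) : ℝ) * z ^ k, by fun_prop⟩

lemma gafTerm_apply (γ : ℝ) (a : ℕ → ℂ) (k : ℕ) (z : ℂ) :
    gafTerm γ a k z = a k * (√(γ ^ k / (k ! : ℝ)) : ℝ) * z ^ k := rfl

lemma norm_gafTerm_apply (γ : ℝ) (a : ℕ → ℂ) (k : ℕ) (z : ℂ) :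
    ‖gafTerm γ a k z‖ = ‖a k‖ * (√(γ ^ k / (k ! : ℝ)) * ‖z‖ ^ k) := by
  rw [gafTerm_apply, norm_mul, norm_mul, norm_pow, Complex.norm_real,
    Real.norm_of_nonneg (Real.sqrt_nonneg _), mul_assoc]

lemma sq_sqrt_pow_div_factorial_le (γ : ℝ) (k : ℕ) :
    √(γ ^ k / (k ! : ℝ)) ^ 2 ≤ |γ| ^ k / (k ! : ℝ) := by
  have hle : γ ^ k / (k ! : ℝ) ≤ |γ| ^ k / (k ! : ℝ) :=
    div_le_div_of_nonneg_right ((le_abs_self _).trans_eq (abs_pow γ k)) (by positivity)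
  calc √(γ ^ k / (k ! : ℝ)) ^ 2 ≤ √(|γ| ^ k / (k ! : ℝ)) ^ 2 := by gcongr
    _ = |γ| ^ k / (k ! : ℝ) := Real.sq_sqrt (by positivity)

lemma one_add_natCast_sq_le (k : ℕ) : 1 + (k : ℝ) ^ 2 ≤ 2 * 4 ^ k := by
  have hk : (k : ℝ) ≤ 2 ^ k := by exact_mod_cast (Nat.lt_two_pow_self (n := k)).le
  have hsq : (k : ℝ) ^ 2 ≤ 4 ^ k := by
    calc (k : ℝ) ^ 2 ≤ (2 ^ k) ^ 2 := by gcongr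
      _ = 4 ^ k := by rw [← pow_mul, mul_comm, pow_mul]; norm_num
  linarith [one_le_pow₀ (M₀ := ℝ) (a := 4) (n := k) (by norm_num)]

lemma summable_weight_mul_gafCoeff_sq (γ r : ℝ) :
    Summable fun k : ℕ => (1 + (k : ℝ) ^ 2) * (√(γ ^ k / (k ! : ℝ)) * r ^ k) ^ 2 := by
  refine ((Real.summable_pow_div_factorial (4 * (|γ| * r ^ 2))).mul_left 2).of_nonneg_of_le
    (fun k => by positivity) fun k => ?_
  calc (1 + (k : ℝ) ^ 2) * (√(γ ^ k / (k ! : ℝ)) * r ^ k) ^ 2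
      = (1 + (k : ℝ) ^ 2) * (√(γ ^ k / (k ! : ℝ)) ^ 2 * (r ^ k) ^ 2) := by rw [mul_pow]
    _ ≤ (2 * 4 ^ k) * (|γ| ^ k / (k ! : ℝ) * (r ^ k) ^ 2) := by
      gcongr
      · exact one_add_natCast_sq_le k
      · exact sq_sqrt_pow_div_factorial_le γ k
    _ = 2 * ((4 * (|γ| * r ^ 2)) ^ k / (k ! : ℝ)) := by
      rw [mul_pow, mul_pow, ← pow_mul, ← pow_mul, mul_comm k 2]
      ring

lemma summable_norm_restrict_gafTerm (γ : ℝ)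
    (ha : Summable fun k : ℕ => ‖a k‖ ^ 2 / (1 + (k : ℝ) ^ 2))
    (K : TopologicalSpace.Compacts ℂ) :
    Summable fun k => ‖(gafTerm γ a k).restrict K‖ := by
  obtain ⟨R, hR, hK⟩ := K.isCompact.isBounded.exists_pos_norm_le
  refine (summable_mul_of_summable_weighted_sq one_add_natCast_sq_pos ha
    (summable_weight_mul_gafCoeff_sq γ R)).of_nonneg_of_le (fun k => norm_nonneg _) fun k => ?_
  refine (ContinuousMap.norm_le _ (by positivity)).2 fun z => ?_
  rw [ContinuousMap.restrict_apply, norm_gafTerm_apply]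
  gcongr
  exact hK z z.2

lemma hasSum_gafTerm (γ : ℝ) (ha : Summable fun k : ℕ => ‖a k‖ ^ 2 / (1 + (k : ℝ) ^ 2)) :
    HasSum (gafTerm γ a) (planarGAF γ a) := by
  have hsum : Summable (gafTerm γ a) :=
    ContinuousMap.summable_of_locally_summable_norm (summable_norm_restrict_gafTerm γ ha)
  have htsum : (fun z => ∑' k, a k * (√(γ ^ k / (k ! : ℝ)) : ℝ) * z ^ k)
      = ∑' k, gafTerm γ a k :=
    funext fun z => (ContinuousMap.tsum_apply hsum z)
  have hcont : Continuous fun z : ℂ => ∑' k, a k * (√(γ ^ k / (k ! : ℝ)) : ℝ) * z ^ k :=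
    htsum ▸ ContinuousMap.continuous _
  have heq : planarGAF γ a = ∑' k, gafTerm γ a k := by
    rw [planarGAF, dif_pos hcont]
    exact DFunLike.coe_injective htsum
  exact heq ▸ hsum.hasSum

lemma hasSum_planarGAF_apply (γ : ℝ) (ha : Summable fun k : ℕ => ‖a k‖ ^ 2 / (1 + (k : ℝ) ^ 2))
    (z : ℂ) :
    HasSum (fun k => a k * (√(γ ^ k / (k ! : ℝ)) : ℝ) * z ^ k) (planarGAF γ a z) :=
  ContinuousMap.hasSum_apply (hasSum_gafTerm γ ha) z

lemma differentiable_planarGAF (γ : ℝ)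
    (ha : Summable fun k : ℕ => ‖a k‖ ^ 2 / (1 + (k : ℝ) ^ 2)) :
    Differentiable ℂ (planarGAF γ a) := by
  have hunif := ContinuousMap.tendsto_iff_tendstoLocallyUniformly.1 (hasSum_gafTerm γ ha)
  refine differentiableOn_univ.1
    ((tendstoLocallyUniformlyOn_univ.2 hunif).differentiableOn (.of_forall fun s => ?_) isOpen_univ)
  simp only [ContinuousMap.coe_sum, gafTerm, ContinuousMap.coe_mk]
  fun_prop

lemma planarGAF_apply_zero (γ : ℝ) (ha : Summable fun k : ℕ => ‖a k‖ ^ 2 / (1 + (k : ℝ) ^ 2)) :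
    planarGAF γ a 0 = a 0 := by
  refine (hasSum_planarGAF_apply γ ha 0).unique ?_
  convert! hasSum_single (α := ℂ) 0 fun k hk => ?_
  · simp
  · simp [hk]

end PlanarGAF

section WeakNorm

variable {H : Type*} [NormedAddCommGroup H] [InnerProductSpace ℂ H] (b : HilbertBasis ℕ ℂ H)

lemma norm_inner_le_norm_toWeak_mul (s : H) {v : H} {c : ℕ → ℝ}
    (hv : ∀ k, ‖inner ℂ v (b k)‖ ≤ c k) (hc : Summable fun k : ℕ => (1 + (k : ℝ) ^ 2) * c k ^ 2) :
    ‖inner ℂ v s‖ ≤ ‖toWeak b s‖ * √(∑' k : ℕ, (1 + (k : ℝ) ^ 2) * c k ^ 2) := by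
  have hs := summable_weak b s
  calc ‖inner ℂ v s‖ = ‖∑' k, inner ℂ v (b k) * inner ℂ (b k) s‖ := by
        rw [(b.hasSum_inner_mul_inner v s).tsum_eq]
    _ ≤ ∑' k, ‖inner ℂ (b k) s‖ * c k := by
        refine tsum_of_norm_bounded
          (summable_mul_of_summable_weighted_sq one_add_natCast_sq_pos hs hc).hasSum fun k => ?_
        rw [norm_mul, mul_comm]
        gcongr
        exact hv k
    _ ≤ ‖toWeak b s‖ * √(∑' k : ℕ, (1 + (k : ℝ) ^ 2) * c k ^ 2) :=
        tsum_mul_le_sqrt_mul_sqrt_weighted one_add_natCast_sq_pos hs hc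

lemma norm_toWeak_sum_sq (a : ℕ → ℂ) (F : Finset ℕ) :
    ‖toWeak b (∑ k ∈ F, a k • b k)‖ ^ 2 = ∑ k ∈ F, ‖a k‖ ^ 2 / (1 + (k : ℝ) ^ 2) := by
  have hinner (k : ℕ) : inner ℂ (b k) (∑ j ∈ F, a j • b j) = if k ∈ F then a k else 0 := by
    simp [orthonormal_iff_ite.1 b.orthonormal]
  rw [weak_norm_def, Real.sq_sqrt (tsum_nonneg fun k => by positivity)]
  simp only [LinearEquiv.symm_apply_apply, hinner]
  rw [tsum_eq_sum (s := F) fun k hk => by simp [hk]]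
  exact Finset.sum_congr rfl fun k hk => by rw [if_pos hk]

lemma tendsto_truncatedNoise {a : ℕ → ℂ}
    (ha : Summable fun k : ℕ => ‖a k‖ ^ 2 / (1 + (k : ℝ) ^ 2)) :
    Tendsto (truncatedNoise b a) atTop (𝓝 (whiteNoise b a)) := by
  refine CauchySeq.tendsto_limUnder (Metric.cauchySeq_iff'.2 fun ε hε => ?_)
  obtain ⟨N, hN⟩ := Metric.cauchySeq_iff'.1 ha.hasSum.tendsto_sum_nat.cauchySeq (ε ^ 2)
    (by positivity)
  refine ⟨N, fun n hn => lt_of_pow_lt_pow_left₀ 2 hε.le ?_⟩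
  calc dist (truncatedNoise b a n) (truncatedNoise b a N) ^ 2
      = ∑ k ∈ Finset.range n with N ≤ k, ‖a k‖ ^ 2 / (1 + (k : ℝ) ^ 2) := by
        rw [truncatedNoise, truncatedNoise, UniformSpace.Completion.dist_eq, dist_eq_norm,
          ← map_sub, Finset.sum_range_sub_sum_range hn, norm_toWeak_sum_sq]
    _ ≤ dist (∑ k ∈ Finset.range n, ‖a k‖ ^ 2 / (1 + (k : ℝ) ^ 2))
        (∑ k ∈ Finset.range N, ‖a k‖ ^ 2 / (1 + (k : ℝ) ^ 2)) := by
        rw [dist_eq_norm, Finset.sum_range_sub_sum_range hn]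
        exact le_abs_self _
    _ < ε ^ 2 := hN n hn

end WeakNorm

section HermiteSTFT

lemma integrable_cexp_mul_poly_gauss (w : ℂ) (p : Polynomial ℝ) :
    Integrable fun x : ℝ => Complex.exp (w * x) * ((p.eval x * Real.exp (-x ^ 2) : ℝ) : ℂ) := by
  refine ((memLp_exp_gauss |w.re|).integrable_mul (memLp_poly_gauss p)).norm.mono' (by fun_prop)
    (ae_of_all _ fun x => ?_)
  have hgauss : Real.exp (-x ^ 2) = Real.exp (-(1 / 2) * x ^ 2) * Real.exp (-(1 / 2) * x ^ 2) := by
    rw [← Real.exp_add]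
    ring_nf
  have hexp : ‖Complex.exp (w * x)‖ ≤ Real.exp (|w.re| * |x|) := by
    rw [Complex.norm_exp, Complex.re_mul_ofReal, ← abs_mul]
    exact Real.exp_le_exp.2 (le_abs_self _)
  calc ‖Complex.exp (w * x) * ((p.eval x * Real.exp (-x ^ 2) : ℝ) : ℂ)‖
      = ‖Complex.exp (w * x)‖
        * (|p.eval x| * (Real.exp (-(1 / 2) * x ^ 2) * Real.exp (-(1 / 2) * x ^ 2))) := by
        rw [norm_mul, Complex.norm_real, Real.norm_eq_abs, abs_mul, Real.abs_exp, hgauss]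
    _ ≤ Real.exp (|w.re| * |x|)
        * (|p.eval x| * (Real.exp (-(1 / 2) * x ^ 2) * Real.exp (-(1 / 2) * x ^ 2))) := by gcongr
    _ = _ := by
        simp only [Pi.mul_apply, norm_mul, Complex.norm_real, Real.norm_eq_abs, Real.abs_exp]
        ring

lemma integral_cexp_mul_gauss (w : ℂ) :
    ∫ x : ℝ, Complex.exp (w * x) * ((Real.exp (-x ^ 2) : ℝ) : ℂ)
      = (√Real.pi : ℝ) * Complex.exp (w ^ 2 / 4) := by
  have h := integral_cexp_quadratic (b := -1) (by simp) w 0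
  have hsqrt : ((Real.pi : ℂ) / -(-1)) ^ (1 / 2 : ℂ) = (√Real.pi : ℝ) := by
    rw [Real.sqrt_eq_rpow, Complex.ofReal_cpow Real.pi_pos.le]
    simp
  rw [hsqrt] at h
  rw [show w ^ 2 / 4 = 0 - w ^ 2 / (4 * -1) by ring, ← h]
  congr 1 with x
  rw [Complex.ofReal_exp, ← Complex.exp_add]
  push_cast
  ring_nf

/-- Each integration by parts moves a derivative from the Hermite factor onto the exponential,
where it produces a factor `w`. -/
lemma integral_cexp_mul_hermPoly (w : ℂ) (n : ℕ) :
    ∫ x : ℝ, Complex.exp (w * x) * (((hermPoly n).eval x * Real.exp (-x ^ 2) : ℝ) : ℂ)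
      = w ^ n * ((√Real.pi : ℝ) * Complex.exp (w ^ 2 / 4)) := by
  induction n with
  | zero => simpa [hermPoly] using integral_cexp_mul_gauss w
  | succ n ih =>
    have hexp (x : ℝ) : HasDerivAt (fun x : ℝ => Complex.exp (w * x))
        (w * Complex.exp (w * x)) x := by
      have hmul : HasDerivAt (fun x : ℝ => w * (x : ℂ)) w x := by
        simpa using (Complex.ofRealCLM.hasDerivAt (x := x)).const_mul w
      simpa [mul_comm] using hmul.cexp
    have hparts := integral_mul_deriv_eq_deriv_mul_of_integrable (fun x _ => hexp x)
      (fun x _ => (hasDerivAt_gauss (hermPoly n) x).ofReal_comp)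
      (by simpa [Pi.mul_def, hermPoly] using!
        (integrable_cexp_mul_poly_gauss w (hermPoly (n + 1))).neg)
      (by simpa [Pi.mul_def, mul_assoc] using
        (integrable_cexp_mul_poly_gauss w (hermPoly n)).const_mul w)
      (integrable_cexp_mul_poly_gauss w (hermPoly n))
    simp only [Complex.ofReal_neg, mul_neg, integral_neg, neg_inj] at hparts
    simp_rw [hermPoly, hparts, mul_assoc w]
    rw [integral_const_mul, ih]
    ring

lemma hermiteFun_normalization_mul (k : ℕ) :
    (√(√Real.pi * 2 ^ k * (k ! : ℝ)))⁻¹ * Real.pi ^ (-(1 / 4) : ℝ) * √Real.pi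
      = √((1 / 2) ^ k / (k ! : ℝ)) := by
  have hroot : √(√Real.pi) = Real.pi ^ (1 / 4 : ℝ) := by
    rw [Real.sqrt_eq_rpow, Real.sqrt_eq_rpow, ← Real.rpow_mul Real.pi_pos.le]
    norm_num
  have hsq : √Real.pi = Real.pi ^ (1 / 4 : ℝ) * Real.pi ^ (1 / 4 : ℝ) := by
    rw [← hroot, Real.mul_self_sqrt (Real.sqrt_nonneg _)]
  have hpos : Real.pi ^ (1 / 4 : ℝ) ≠ 0 := (Real.rpow_pos_of_pos Real.pi_pos _).ne'
  rw [mul_assoc √Real.pi, Real.sqrt_mul (Real.sqrt_nonneg _), hroot, Real.rpow_neg Real.pi_pos.le,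
    hsq, one_div 2, inv_pow, div_eq_mul_inv _ (k ! : ℝ), ← mul_inv (2 ^ k : ℝ), Real.sqrt_inv]
  field_simp

lemma conj_gaussWindow (t : ℝ) : conj (gaussWindow t) = gaussWindow t := Complex.conj_ofReal _

lemma neg_I_mul_eq (z : ℂ) : -Complex.I * z = z.im - Complex.I * z.re := by
  nth_rw 1 [← Complex.re_add_im z]
  linear_combination -(z.im : ℂ) * Complex.I_sq

lemma hermiteFun_mul_gaussWindow_mul_cexp (k : ℕ) (z : ℂ) (u : ℝ) :
    (hermiteFun k u : ℂ) * conj (gaussWindow (u - z.im)) * Complex.exp (-(Complex.I * z.re * u))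
      = ((√(√Real.pi * 2 ^ k * (k ! : ℝ)))⁻¹ * Real.pi ^ (-(1 / 4) : ℝ) : ℝ)
        * Complex.exp (-(z.im : ℂ) ^ 2 / 2)
        * (Complex.exp (-Complex.I * z * u)
          * (((hermPoly k).eval u * Real.exp (-u ^ 2) : ℝ) : ℂ)) := by
  have hexp : Complex.exp (-(1 / 2) * u ^ 2) * Complex.exp (-(u - z.im) ^ 2 / 2)
      * Complex.exp (-(Complex.I * z.re * u))
      = Complex.exp (-(z.im : ℂ) ^ 2 / 2) * Complex.exp (-Complex.I * z * u)
        * Complex.exp (-u ^ 2) := by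
    rw [neg_I_mul_eq]
    simp only [← Complex.exp_add]
    ring_nf
  rw [conj_gaussWindow, hermiteFun_eq, gaussWindow]
  push_cast
  linear_combination ((√(√Real.pi * 2 ^ k * (k ! : ℝ)) : ℝ) : ℂ)⁻¹
    * ((Real.pi ^ (-(1 / 4) : ℝ) : ℝ) : ℂ) * (((hermPoly k).eval u : ℝ) : ℂ) * hexp

lemma stftFactor_apply_eq_mul_cexp (z : ℂ) :
    stftFactor z = Complex.exp (-(z.im : ℂ) ^ 2 / 2) * Complex.exp ((-Complex.I * z) ^ 2 / 4) := by
  change Complex.exp _ = _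
  rw [← Complex.exp_add, neg_I_mul_eq, ← Complex.normSq_eq_norm_sq, Complex.normSq_apply]
  congr 1
  push_cast
  linear_combination (-(z.re : ℂ) ^ 2 / 4) * Complex.I_sq

lemma gaussSTFT_hermiteSignal (k : ℕ) :
    gaussSTFT (hermiteSignal k) = stftFactor * gafTerm (1 / 2) (fun k => (-Complex.I) ^ k) k := by
  ext z
  calc gaussSTFT (hermiteSignal k) z
      = ∫ u : ℝ, (hermiteFun k u : ℂ) * conj (gaussWindow (u - z.im))
          * Complex.exp (-(Complex.I * z.re * u)) := by
        refine integral_congr_ae ?_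
        filter_upwards [(memLp_hermiteFun k).coeFn_toLp] with u hu
        rw [hermiteSignal, hu]
    _ = ((√(√Real.pi * 2 ^ k * (k ! : ℝ)))⁻¹ * Real.pi ^ (-(1 / 4) : ℝ) : ℝ)
          * Complex.exp (-(z.im : ℂ) ^ 2 / 2) * ((-Complex.I * z) ^ k
            * ((√Real.pi : ℝ) * Complex.exp ((-Complex.I * z) ^ 2 / 4))) := by
        simp_rw [hermiteFun_mul_gaussWindow_mul_cexp]
        rw [integral_const_mul, integral_cexp_mul_hermPoly]
    _ = stftFactor z * gafTerm (1 / 2) (fun k => (-Complex.I) ^ k) k z := by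
        rw [stftFactor_apply_eq_mul_cexp, gafTerm_apply, ← hermiteFun_normalization_mul, mul_pow]
        push_cast
        ring

end HermiteSTFT

section NoiseSTFT

lemma stftFactor_ne_zero (z : ℂ) : stftFactor z ≠ 0 := Complex.exp_ne_zero _

lemma norm_stftFactor_le_one (z : ℂ) : ‖stftFactor z‖ ≤ 1 := by
  change ‖Complex.exp _‖ ≤ 1
  rw [Complex.norm_exp, Real.exp_le_one_iff]
  have hsq : 0 ≤ ‖z‖ ^ 2 / 4 := by positivity
  simp only [Complex.sub_re, Complex.neg_re, Complex.ofReal_re, Complex.div_ofNat_re,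
    Complex.mul_re, Complex.I_re, Complex.I_im, Complex.ofReal_im, Complex.mul_im]
  linarith

/-- The Gabor atom `u ↦ g(u - t) exp(i ω u)` at `z = ω + i t`: the Gaussian Short-Time Fourier
Transform at `z` is the inner product with it. -/
def gaborFun (z : ℂ) (u : ℝ) : ℂ :=
  gaussWindow (u - z.im) * Complex.exp (Complex.I * z.re * u)

lemma memLp_gaborFun (z : ℂ) : MemLp (gaborFun z) 2 volume := by
  have hcont : Continuous (gaborFun z) := by unfold gaborFun gaussWindow; fun_prop
  rw [memLp_two_iff_integrable_sq_norm hcont.aestronglyMeasurable]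
  refine (((integrable_exp_neg_mul_sq (b := 1) one_pos).comp_sub_right z.im).const_mul
    ((Real.pi ^ (-(1 / 4) : ℝ)) ^ 2)).congr (ae_of_all _ fun u => ?_)
  have hexp : ‖Complex.exp (Complex.I * z.re * u)‖ = 1 := by rw [Complex.norm_exp]; simp
  simp only [gaborFun, norm_mul, hexp, mul_one, gaussWindow]
  rw [Complex.norm_real, Real.norm_of_nonneg (by positivity), mul_pow, ← Real.exp_nat_mul]
  ring_nf

/-- The Gabor atom at `z` as an element of `L²(ℝ)`. -/
def gaborSignal (z : ℂ) : Signal := (memLp_gaborFun z).toLp _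

lemma gaussSTFT_apply_eq_inner (s : Signal) (z : ℂ) :
    gaussSTFT s z = inner ℂ (gaborSignal z) s := by
  rw [L2.inner_def]
  refine integral_congr_ae ?_
  filter_upwards [(memLp_gaborFun z).coeFn_toLp] with u hu
  rw [gaborSignal, hu, RCLike.inner_apply, gaborFun, map_mul, ← Complex.exp_conj, mul_assoc]
  simp

lemma gaussSTFT_sub_apply (s t : Signal) (z : ℂ) :
    gaussSTFT (s - t) z = gaussSTFT s z - gaussSTFT t z := by
  simp only [gaussSTFT_apply_eq_inner, inner_sub_right]

lemma gaussSTFT_sum_smul {ι : Type*} (F : Finset ι) (c : ι → ℂ) (s : ι → Signal) :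
    gaussSTFT (∑ i ∈ F, c i • s i) = ∑ i ∈ F, c i • gaussSTFT (s i) := by
  ext z
  simp [gaussSTFT_apply_eq_inner, inner_sum, inner_smul_right]

lemma norm_gaussSTFT_hermiteSignal_apply_le (k : ℕ) {z : ℂ} {R : ℝ} (hz : ‖z‖ ≤ R) :
    ‖gaussSTFT (hermiteSignal k) z‖ ≤ √((1 / 2) ^ k / (k ! : ℝ)) * R ^ k := by
  rw [gaussSTFT_hermiteSignal, ContinuousMap.mul_apply, norm_mul, norm_gafTerm_apply, norm_pow,
    norm_neg, Complex.norm_I, one_pow, one_mul]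
  calc ‖stftFactor z‖ * (√((1 / 2) ^ k / (k ! : ℝ)) * ‖z‖ ^ k)
      ≤ 1 * (√((1 / 2) ^ k / (k ! : ℝ)) * R ^ k) := by
        gcongr
        exact norm_stftFactor_le_one z
    _ = _ := one_mul _

lemma exists_norm_gaussSTFT_apply_le {K : Set ℂ} (hK : IsCompact K) :
    ∃ M > 0, ∀ s : Signal, ∀ z ∈ K, ‖gaussSTFT s z‖ ≤ ‖toWeak hermiteBasis s‖ * M := by
  obtain ⟨R, hR⟩ := hK.isBounded.exists_norm_le
  refine ⟨√(∑' k : ℕ, (1 + (k : ℝ) ^ 2) * (√((1 / 2) ^ k / (k ! : ℝ)) * R ^ k) ^ 2) + 1,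
    by positivity, fun s z hz => ?_⟩
  rw [gaussSTFT_apply_eq_inner]
  refine (norm_inner_le_norm_toWeak_mul hermiteBasis s (fun k => ?_)
    (summable_weight_mul_gafCoeff_sq (1 / 2) R)).trans
      (mul_le_mul_of_nonneg_left (le_add_of_nonneg_right zero_le_one) (norm_nonneg _))
  rw [hermiteBasis_apply, ← gaussSTFT_apply_eq_inner]
  exact norm_gaussSTFT_hermiteSignal_apply_le k (hR z hz)

lemma uniformContinuous_gaussSTFT :
    UniformContinuous
      fun s : Weakened hermiteBasis => gaussSTFT ((toWeak hermiteBasis).symm s) := by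
  rw [Metric.uniformity_basis_dist.uniformContinuous_iff
    ContinuousMap.hasBasis_compactConvergenceUniformity]
  rintro ⟨K, V⟩ ⟨hK, hV⟩
  obtain ⟨ε, hε, hεV⟩ := Metric.mem_uniformity_dist.1 hV
  obtain ⟨M, hM, hbound⟩ := exists_norm_gaussSTFT_apply_le hK
  refine ⟨ε / M, by positivity, fun s t hst z hz => hεV ?_⟩
  calc dist (gaussSTFT ((toWeak hermiteBasis).symm s) z)
        (gaussSTFT ((toWeak hermiteBasis).symm t) z)
      = ‖gaussSTFT ((toWeak hermiteBasis).symm (s - t)) z‖ := by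
        rw [dist_eq_norm, ← gaussSTFT_sub_apply, ← map_sub]
    _ ≤ ‖s - t‖ * M := by simpa using hbound ((toWeak hermiteBasis).symm (s - t)) z hz
    _ < ε / M * M := by
        gcongr
        rwa [← dist_eq_norm]
    _ = ε := by field_simp

lemma continuous_noiseSTFT : Continuous noiseSTFT :=
  UniformSpace.Completion.continuous_extension

lemma noiseSTFT_toWeak (s : Signal) :
    noiseSTFT (toWeak hermiteBasis s : Weakened hermiteBasis) = gaussSTFT s :=
  (UniformSpace.Completion.extension_coe uniformContinuous_gaussSTFT _).trans (by simp)

lemma noiseSTFT_truncatedNoise (a : ℕ → ℂ) (n : ℕ) :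
    noiseSTFT (truncatedNoise hermiteBasis a n)
      = stftFactor * ∑ k ∈ Finset.range n, gafTerm (1 / 2) (fun k => (-Complex.I) ^ k * a k) k := by
  rw [truncatedNoise, noiseSTFT_toWeak, gaussSTFT_sum_smul, Finset.mul_sum]
  refine Finset.sum_congr rfl fun k _ => ?_
  rw [hermiteBasis_apply, gaussSTFT_hermiteSignal]
  ext z
  simp only [ContinuousMap.smul_apply, ContinuousMap.mul_apply, gafTerm_apply, smul_eq_mul]
  ring

lemma noiseSTFT_whiteNoise {a : ℕ → ℂ}
    (ha : Summable fun k : ℕ => ‖a k‖ ^ 2 / (1 + (k : ℝ) ^ 2)) :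
    noiseSTFT (whiteNoise hermiteBasis a)
      = stftFactor * planarGAF (1 / 2) (fun k => (-Complex.I) ^ k * a k) := by
  have hGAF := (hasSum_gafTerm (1 / 2) (a := fun k => (-Complex.I) ^ k * a k)
    (by simpa using ha)).tendsto_sum_nat.const_mul stftFactor
  refine tendsto_nhds_unique
    ((continuous_noiseSTFT.tendsto _).comp (tendsto_truncatedNoise hermiteBasis ha)) ?_
  exact hGAF.congr fun n => (noiseSTFT_truncatedNoise a n).symm

lemma setOf_spectrogram_stftFactor_mul_eq_zero (f : C(ℂ, ℂ)) :
    {z | spectrogram (stftFactor * f) z = 0} = {z | f z = 0} := by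
  ext z
  simp [spectrogram, stftFactor_ne_zero]

end NoiseSTFT

section StdComplexGaussian

lemma measurePreserving_stdComplexGaussian :
    MeasurePreserving (fun p : ℝ × ℝ => ((p.1 : ℂ) + Complex.I * p.2) / (√2 : ℝ))
      ((gaussianReal 0 1).prod (gaussianReal 0 1)) stdComplexGaussian :=
  ⟨by fun_prop, rfl⟩

lemma measurePreserving_stdGaussian_stdComplexGaussian :
    MeasurePreserving (fun z : ℂ => ((√2)⁻¹ : ℝ) • z) (stdGaussian ℂ) stdComplexGaussian := by
  refine ⟨by fun_prop, ?_⟩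
  rw [stdGaussian_eq_map_pi_orthonormalBasis Complex.orthonormalBasisOneI,
    Measure.map_map (by fun_prop) (by fun_prop), ← (measurePreserving_stdComplexGaussian.comp
      (measurePreserving_finTwoArrow (gaussianReal 0 1))).map_eq]
  congr 1 with x
  simp [div_eq_inv_mul, mul_comm Complex.I]

instance : IsGaussian stdComplexGaussian := by
  rw [← measurePreserving_stdGaussian_stdComplexGaussian.map_eq]
  exact isGaussian_map (((√2)⁻¹ : ℝ) • ContinuousLinearMap.id ℝ ℂ)

instance : NullSingletonClass stdComplexGaussian where
  measure_singleton z := by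
    have := nullSingletonClass_gaussianReal (μ := 0) (v := 1) one_ne_zero
    rw [← measurePreserving_stdComplexGaussian.measure_preimage
      (measurableSet_singleton z).nullMeasurableSet]
    refine Set.Subsingleton.measure_zero (fun p hp q hq => ?_) _
    have hsqrt : ((√2 : ℝ) : ℂ) ≠ 0 := Complex.ofReal_ne_zero.2 (by positivity)
    have hpq : (p.1 : ℂ) + Complex.I * p.2 = q.1 + Complex.I * q.2 :=
      (div_left_inj' hsqrt).1 (Eq.trans hp hq.symm)
    exact Prod.ext (by simpa using congrArg Complex.re hpq) (by simpa using congrArg Complex.im hpq)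

lemma measurePreserving_mul_stdComplexGaussian {u : ℂ} (hu : ‖u‖ = 1) :
    MeasurePreserving (fun z : ℂ => u * z) stdComplexGaussian stdComplexGaussian := by
  have hrot : MeasurePreserving (fun z : ℂ => u * z) (stdGaussian ℂ) (stdGaussian ℂ) :=
    ⟨by fun_prop, stdGaussian_map (rotation ⟨u, mem_sphere_zero_iff_norm.2 hu⟩)⟩
  refine ⟨by fun_prop, ?_⟩
  nth_rw 1 [← measurePreserving_stdGaussian_stdComplexGaussian.map_eq]
  rw [Measure.map_map (by fun_prop) (by fun_prop),
    ← (measurePreserving_stdGaussian_stdComplexGaussian.comp hrot).map_eq]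
  congr 1 with z
  simp only [Function.comp_apply, mul_smul_comm]

lemma integrable_norm_sq_stdComplexGaussian :
    Integrable (fun z : ℂ => ‖z‖ ^ 2) stdComplexGaussian :=
  IsGaussian.memLp_two_id.integrable_norm_pow two_ne_zero

end StdComplexGaussian

lemma summable_one_div_one_add_natCast_sq : Summable fun k : ℕ => 1 / (1 + (k : ℝ) ^ 2) := by
  refine ((Real.summable_one_div_nat_pow (p := 2)).2 one_lt_two).of_norm_bounded_eventually_nat ?_
  filter_upwards [eventually_gt_atTop 0] with k hk
  rw [Real.norm_of_nonneg (by positivity)]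
  gcongr
  linarith

section GaussianSequences

variable {Ω Ω' : Type*} [MeasurableSpace Ω] [MeasurableSpace Ω'] {P : Measure Ω} {P' : Measure Ω'}
  {ξ : ℕ → Ω → ℂ} {η : ℕ → Ω' → ℂ}

lemma ae_summable_mul_comp_of_hasLaw {ι E : Type*} [Countable ι] [MeasurableSpace E]
    {μ : Measure E} {X : ι → Ω → E} (hX : ∀ i, HasLaw (X i) μ P) {f : E → ℝ} (hf : Integrable f μ)
    {c : ι → ℝ} (hc : Summable c) : ∀ᵐ x ∂P, Summable fun i => c i * f (X i x) := by
  have hmeas (i : ι) : AEStronglyMeasurable (fun x => f (X i x)) P :=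
    AEStronglyMeasurable.comp_aemeasurable (by simpa [(hX i).map_eq] using hf.1) (hX i).aemeasurable
  have hnorm (i : ι) : eLpNorm (fun x => c i * f (X i x)) 1 P = ‖c i‖ₑ * eLpNorm f 1 μ := by
    rw [← (hX i).map_eq, eLpNorm_map_measure (by simpa [(hX i).map_eq] using hf.1)
      (hX i).aemeasurable]
    exact eLpNorm_const_smul (c i) (f ∘ X i) 1 P
  have h := summable_norm_of_tsum_eLpNorm_ne_top le_rfl (fun i => (hmeas i).const_mul (c i)) (by
    simp_rw [hnorm]
    rw [ENNReal.tsum_mul_right]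
    exact ENNReal.mul_ne_top (tsum_enorm_ne_top_iff_summable_norm.2 hc.norm)
      (memLp_one_iff_integrable.2 hf).eLpNorm_ne_top)
  filter_upwards [h] with x hx using hx.of_norm

lemma ae_summable_norm_sq_div_of_hasLaw (hξ : ∀ k, HasLaw (ξ k) stdComplexGaussian P) :
    ∀ᵐ x ∂P, Summable fun k : ℕ => ‖ξ k x‖ ^ 2 / (1 + (k : ℝ) ^ 2) := by
  simpa only [one_div_mul_eq_div] using ae_summable_mul_comp_of_hasLaw hξ
    integrable_norm_sq_stdComplexGaussian summable_one_div_one_add_natCast_sq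

lemma IsStdComplexGaussianSeq.const_mul (hξ : IsStdComplexGaussianSeq ξ P) {u : ℕ → ℂ}
    (hu : ∀ k, ‖u k‖ = 1) : IsStdComplexGaussianSeq (fun k x => u k * ξ k x) P where
  hasLaw k := (measurePreserving_mul_stdComplexGaussian (hu k)).fun_comp_hasLaw (hξ.hasLaw k)
  indep := hξ.indep.comp (fun k z => u k * z) fun k => by fun_prop

lemma IsStdComplexGaussianSeq.hasLaw_infinitePi (hξ : IsStdComplexGaussianSeq ξ P) :
    HasLaw (fun x k => ξ k x) (Measure.infinitePi fun _ : ℕ => stdComplexGaussian) P where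
  aemeasurable := aemeasurable_pi_iff.2 fun k => (hξ.hasLaw k).aemeasurable
  map_eq := by
    rw [hξ.indep.map_fun_eq_infinitePi_map₀' fun k => (hξ.hasLaw k).aemeasurable]
    simp_rw [(hξ.hasLaw _).map_eq]

lemma continuous_gafTerm (γ : ℝ) (k : ℕ) : Continuous fun a => gafTerm γ a k := by
  refine ContinuousMap.continuous_of_continuous_uncurry _ ?_
  change Continuous fun p : (ℕ → ℂ) × ℂ => p.1 k * (√(γ ^ k / (k ! : ℝ)) : ℝ) * p.2 ^ k
  fun_prop

lemma aemeasurable_planarGAF (γ : ℝ) :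
    AEMeasurable (planarGAF γ) (Measure.infinitePi fun _ : ℕ => stdComplexGaussian) := by
  refine aemeasurable_of_tendsto_metrizable_ae atTop
    (f := fun n a => ∑ k ∈ Finset.range n, gafTerm γ a k)
    (fun n => (continuous_finsetSum _ fun k _ => continuous_gafTerm γ k).aemeasurable) ?_
  filter_upwards [ae_summable_norm_sq_div_of_hasLaw fun k =>
    (measurePreserving_eval_infinitePi (fun _ : ℕ => stdComplexGaussian) k).hasLaw] with a ha
  exact (hasSum_gafTerm γ ha).tendsto_sum_nat

lemma identDistrib_planarGAF (γ : ℝ) (hξ : IsStdComplexGaussianSeq ξ P)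
    (hη : IsStdComplexGaussianSeq η P') :
    IdentDistrib (fun x => planarGAF γ (fun k => ξ k x)) (fun y => planarGAF γ (fun k => η k y))
      P P' :=
  (hξ.hasLaw_infinitePi.identDistrib hη.hasLaw_infinitePi).comp_of_aemeasurable (u := planarGAF γ)
    (by simpa only [hξ.hasLaw_infinitePi.map_eq] using aemeasurable_planarGAF γ)

lemma IsStdComplexGaussianSeq.ae_planarGAF_apply_zero_ne_zero (hξ : IsStdComplexGaussianSeq ξ P)
    (γ : ℝ) :
    ∀ᵐ x ∂P, planarGAF γ (fun k => ξ k x) 0 ≠ 0 := by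
  filter_upwards [ae_summable_norm_sq_div_of_hasLaw hξ.hasLaw,
    ((hξ.hasLaw 0).ae_iff (measurable_id.eq_const 0).not).2 (stdComplexGaussian.ae_ne 0)]
    with x hx hx0
  rwa [planarGAF_apply_zero γ hx]

end GaussianSequences

section ZeroProcess

lemma measurableSet_setOf_preimage_inter_nonempty {X Y : Type*} [TopologicalSpace X]
    [TopologicalSpace Y] [MeasurableSpace C(X, Y)] [OpensMeasurableSpace C(X, Y)] {C : Set Y}
    (hC : IsClosed C) {A : Set X} (hA : IsSigmaCompact A) :
    MeasurableSet {f : C(X, Y) | (f ⁻¹' C ∩ A).Nonempty} := by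
  obtain ⟨K, hK, rfl⟩ := hA
  have hmaps (n : ℕ) : MeasurableSet {f : C(X, Y) | Set.MapsTo f (K n) Cᶜ} :=
    (ContinuousMap.isOpen_setOfPred_mapsTo (hK n) hC.isOpen_compl).measurableSet
  convert! MeasurableSet.iUnion fun n => (hmaps n).compl using 1
  ext f
  simp only [Set.mem_ofPred_eq, Set.inter_iUnion, Set.nonempty_iUnion, Set.mem_iUnion,
    Set.mem_compl_iff, Set.mapsTo_iff_subset_preimage, Set.preimage_compl,
    Set.subset_compl_iff_disjoint_left, Set.not_disjoint_iff_nonempty_inter]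

lemma natCast_le_encard_iff_exists_pairwiseDisjoint {X : Type*} [TopologicalSpace X] [T2Space X]
    {B : Set (Set X)} (hB : TopologicalSpace.IsTopologicalBasis B) {Z : Set X} {n : ℕ} :
    (n : ℕ∞) ≤ Z.encard ↔ ∃ T ⊆ B, T.encard = n ∧ T.PairwiseDisjoint id ∧
      ∀ V ∈ T, (Z ∩ V).Nonempty := by
  constructor
  · intro h
    obtain ⟨t, htZ, htn⟩ := Set.exists_subset_encard_eq h
    obtain ⟨U, hU, hdisj⟩ := (Set.finite_of_encard_eq_coe htn).t2_separation
    choose V hVB hxV hVU using fun x => hB.exists_subset_of_mem_open (hU x).1 (hU x).2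
    have hVdisj : t.PairwiseDisjoint V := hdisj.mono fun x => hVU x
    have hVinj : t.InjOn V := fun x hx y hy hxy =>
      hVdisj.elim_set hx hy x (hxV x) (hxy ▸ hxV x)
    refine ⟨V '' t, Set.image_subset_iff.2 fun x _ => hVB x, hVinj.encard_image.trans htn,
      hVinj.pairwiseDisjoint_image.2 hVdisj, ?_⟩
    rintro _ ⟨x, hx, rfl⟩
    exact ⟨x, htZ hx, hxV x⟩
  · rintro ⟨T, -, hTn, hT, hne⟩
    choose x hxZ hxV using fun V : T => hne V V.2
    have hinj : Function.Injective x := fun V W hVW =>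
      Subtype.ext (hT.elim_set V.2 W.2 (x V) (hxV V) (hVW ▸ hxV W))
    rw [← hTn]
    exact Function.Embedding.encard_le
      ⟨Set.codRestrict x Z hxZ, (Set.injective_codRestrict hxZ).2 hinj⟩

lemma measurable_encard_preimage_inter {X Y : Type*} [TopologicalSpace X] [T2Space X]
    [LocallyCompactSpace X] [SecondCountableTopology X] [TopologicalSpace Y]
    [MeasurableSpace C(X, Y)] [OpensMeasurableSpace C(X, Y)] {C : Set Y} (hC : IsClosed C)
    {U : Set X} (hU : IsOpen U) : Measurable fun f : C(X, Y) => (f ⁻¹' C ∩ U).encard := by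
  have hB := TopologicalSpace.isBasis_countableBasis X
  have hσ {V : Set X} (hV : IsOpen V) : IsSigmaCompact V := by
    have := hV.locallyCompactSpace
    exact isSigmaCompact_iff_sigmaCompactSpace.2 inferInstance
  have hle (n : ℕ) : MeasurableSet {f : C(X, Y) | (n : ℕ∞) ≤ (f ⁻¹' C ∩ U).encard} := by
    have hcountable : {T | T.Finite ∧ T ⊆ TopologicalSpace.countableBasis X}.Countable :=
      Set.countable_ofPred_finite_subset (TopologicalSpace.countable_countableBasis X)
    have : {f : C(X, Y) | (n : ℕ∞) ≤ (f ⁻¹' C ∩ U).encard} =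
        ⋃ T ∈ {T | T ⊆ TopologicalSpace.countableBasis X ∧ T.encard = n ∧ T.PairwiseDisjoint id},
          ⋂ V ∈ T, {f : C(X, Y) | (f ⁻¹' C ∩ (U ∩ V)).Nonempty} := by
      ext f
      simp [natCast_le_encard_iff_exists_pairwiseDisjoint hB, Set.inter_assoc, and_assoc]
    rw [this]
    refine MeasurableSet.biUnion (hcountable.mono ?_) fun T hT => ?_
    · exact fun T hT => ⟨Set.finite_of_encard_eq_coe hT.2.1, hT.1⟩
    refine MeasurableSet.biInter (Set.finite_of_encard_eq_coe hT.2.1).countable fun V hV => ?_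
    exact measurableSet_setOf_preimage_inter_nonempty hC (hσ (hU.inter (hB.isOpen (hT.1 hV))))
  refine ENat.measurable_iff.2 fun n => ?_
  convert! (hle n).diff (hle (n + 1)) using 1
  ext f
  simp [← ENat.lt_add_one_iff (ENat.natCast_ne_top n), le_antisymm_iff, and_comm]

lemma measurable_measure_of_isOpen {α X : Type*} [MeasurableSpace α] [TopologicalSpace X]
    [MeasurableSpace X] [BorelSpace X] {κ : α → Measure X}
    (hκ : ∀ V, IsOpen V → Measurable fun a => κ a V) {U : ℕ → Set X} (hU : ∀ n, IsOpen (U n))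
    (hmono : Monotone U) (hcover : ⋃ n, U n = Set.univ) (hfin : ∀ a n, κ a (U n) < ⊤) :
    Measurable κ := by
  have hrestrict (n : ℕ) : Measurable fun a => (κ a).restrict (U n) := by
    have (a : α) : IsFiniteMeasure ((κ a).restrict (U n)) :=
      isFiniteMeasure_restrict.2 (hfin a n).ne
    refine Measurable.measure_of_isPiSystem BorelSpace.measurable_eq isPiSystem_isOpen
      (fun V hV => ?_) (by simpa using hκ _ (hU n))
    simpa only [Measure.restrict_apply (IsOpen.measurableSet hV)] using hκ _ (hV.inter (hU n))
  refine Measure.measurable_of_measurable_coe _ fun s hs => ?_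
  have (a : α) : κ a s = ⨆ n, (κ a).restrict (U n) s := by
    rw [← Measure.restrict_iUnion_apply_eq_iSup hmono.directed_le hs, hcover, Measure.restrict_univ]
  simp_rw [this]
  exact Measurable.iSup fun n => (Measure.measurable_coe hs).comp (hrestrict n)

/-- The continuous functions on the plane having finitely many zeros in each disc. -/
def locallyFiniteZeros : Set C(ℂ, ℂ) :=
  {f | ∀ n : ℕ, ({z | f z = 0} ∩ Metric.ball 0 n).Finite}

lemma measurable_encard_zeros_inter {U : Set ℂ} (hU : IsOpen U) :
    Measurable fun f : C(ℂ, ℂ) => ({z | f z = 0} ∩ U).encard :=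
  measurable_encard_preimage_inter isClosed_singleton hU

lemma measurableSet_locallyFiniteZeros : MeasurableSet locallyFiniteZeros := by
  simp only [locallyFiniteZeros, ← Set.encard_lt_top_iff, Set.ofPred_forall]
  exact MeasurableSet.iInter fun n =>
    measurable_encard_zeros_inter Metric.isOpen_ball (.of_discrete (s := Set.Iio ⊤))

lemma pointCount_zeros_apply (f : C(ℂ, ℂ)) {U : Set ℂ} (hU : IsOpen U) :
    pointCount {z | f z = 0} U = ({z | f z = 0} ∩ U).encard := by
  have hzeros : IsClosed {z | f z = 0} := isClosed_eq f.continuous continuous_const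
  rw [pointCount, Measure.restrict_apply hU.measurableSet, Set.inter_comm,
    Measure.count_apply (hzeros.measurableSet.inter hU.measurableSet)]

-- The indicator makes the measures locally finite, hence determined by their values on open sets.
lemma measurable_indicator_pointCount_zeros :
    Measurable (locallyFiniteZeros.indicator fun f => pointCount {z | f z = 0}) := by
  have hindicator (V : Set ℂ) (f : C(ℂ, ℂ)) :
      locallyFiniteZeros.indicator (fun f => pointCount {z | f z = 0}) f V =
        locallyFiniteZeros.indicator (fun f => pointCount {z | f z = 0} V) f := by
    by_cases hf : f ∈ locallyFiniteZeros <;> simp [hf]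
  refine measurable_measure_of_isOpen (fun V hV => ?_) (fun n : ℕ => Metric.isOpen_ball)
    (fun m n hmn => Metric.ball_subset_ball (Nat.cast_le.2 hmn)) (Metric.iUnion_ball_nat 0)
    fun f n => ?_
  · simp_rw [hindicator, pointCount_zeros_apply _ hV]
    have := measurable_encard_zeros_inter hV
    exact Measurable.indicator (by fun_prop) measurableSet_locallyFiniteZeros
  · rw [hindicator]
    by_cases hf : f ∈ locallyFiniteZeros
    · simpa [hf, pointCount_zeros_apply f Metric.isOpen_ball] using hf n
    · simp [hf]

lemma identDistrib_pointCount_zeros {Ω Ω' : Type*} [MeasurableSpace Ω] [MeasurableSpace Ω']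
    {P : Measure Ω} {P' : Measure Ω'} {F : Ω → C(ℂ, ℂ)} {G : Ω' → C(ℂ, ℂ)}
    (h : IdentDistrib F G P P') (hF : ∀ᵐ x ∂P, F x ∈ locallyFiniteZeros) :
    IdentDistrib (fun x => pointCount {z | F x z = 0}) (fun y => pointCount {z | G y z = 0})
      P P' := by
  refine h.comp_of_aemeasurable (u := fun f : C(ℂ, ℂ) => pointCount {z | f z = 0})
    ⟨_, measurable_indicator_pointCount_zeros, ?_⟩
  filter_upwards [(ae_map_iff h.aemeasurable_fst measurableSet_locallyFiniteZeros).2 hF] with f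
    (hf : f ∈ locallyFiniteZeros)
  exact (Set.indicator_of_mem hf fun f => pointCount {z | f z = 0}).symm

lemma mem_locallyFiniteZeros_of_differentiable {f : C(ℂ, ℂ)} (hf : Differentiable ℂ f) {z₀ : ℂ}
    (hz₀ : f z₀ ≠ 0) : f ∈ locallyFiniteZeros := by
  have hzeros : f ⁻¹' {0}ᶜ ∈ codiscrete ℂ :=
    AnalyticOnNhd.preimage_zero_mem_codiscrete (fun z _ => hf.analyticAt z) hz₀
  intro n
  have hfinite := (isCompact_closedBall (0 : ℂ) n).finite_sdiff_of_mem_codiscreteWithin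
    (codiscreteWithin_mono (Set.subset_univ _) hzeros)
  exact hfinite.subset fun z hz => ⟨Metric.ball_subset_closedBall hz.2, not_not.2 hz.1⟩

lemma IsStdComplexGaussianSeq.ae_planarGAF_mem_locallyFiniteZeros {Ω : Type*} [MeasurableSpace Ω]
    {P : Measure Ω} {ξ : ℕ → Ω → ℂ} (hξ : IsStdComplexGaussianSeq ξ P) (γ : ℝ) :
    ∀ᵐ x ∂P, planarGAF γ (fun k => ξ k x) ∈ locallyFiniteZeros := by
  filter_upwards [ae_summable_norm_sq_div_of_hasLaw hξ.hasLaw,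
    hξ.ae_planarGAF_apply_zero_ne_zero γ] with x hx hx0
  exact mem_locallyFiniteZeros_of_differentiable (differentiable_planarGAF γ hx) hx0

end ZeroProcess

end WhiteNoise

end

theorem mainTheorem1 {Ω Ω' : Type*} [MeasurableSpace Ω] [MeasurableSpace Ω']
    (P : Measure Ω) [IsProbabilityMeasure P] (P' : Measure Ω') [IsProbabilityMeasure P']
    (ξ : ℕ → Ω → ℂ) (hξ : IsStdComplexGaussianSeq ξ P)
    (η : ℕ → Ω' → ℂ) (hη : IsStdComplexGaussianSeq η P') :
    -- the Gaussian STFT extends continuously to the space of white noise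
    (Continuous noiseSTFT ∧
      ∀ s : Signal, noiseSTFT (toWeak hermiteBasis s : Weakened hermiteBasis) = gaussSTFT s) ∧
    -- the series defining white noise converges almost surely
    (∀ᵐ x ∂P, Tendsto (truncatedNoise hermiteBasis (fun k => ξ k x)) atTop
      (𝓝 (whiteNoise hermiteBasis (fun k => ξ k x)))) ∧
    -- the planar GAF of parameter 1/2 is almost surely an entire function, sum of its series
    (∀ᵐ y ∂P', Differentiable ℂ (planarGAF (1 / 2) (fun k => η k y)) ∧
      ∀ z : ℂ, HasSum (fun k : ℕ => η k y * (√((1 / 2) ^ k / (k ! : ℝ)) : ℝ) * z ^ k)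
        (planarGAF (1 / 2) (fun k => η k y) z)) ∧
    -- the factor does not vanish
    (∀ z : ℂ, stftFactor z ≠ 0) ∧
    -- equality in law of random continuous functions on the plane
    IdentDistrib (fun x => noiseSTFT (whiteNoise hermiteBasis (fun k => ξ k x)))
      (fun y => stftFactor * planarGAF (1 / 2) (fun k => η k y)) P P' ∧
    -- the zeros of the spectrogram of white noise are those of a planar GAF ...
    (∃ ζ : ℕ → Ω → ℂ, IsStdComplexGaussianSeq ζ P ∧
      ∀ᵐ x ∂P,
        noiseSTFT (whiteNoise hermiteBasis (fun k => ξ k x))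
          = stftFactor * planarGAF (1 / 2) (fun k => ζ k x) ∧
        {z : ℂ | spectrogram (noiseSTFT (whiteNoise hermiteBasis (fun k => ξ k x))) z = 0}
          = {z : ℂ | planarGAF (1 / 2) (fun k => ζ k x) z = 0}) ∧
    -- ... and have, as a point process, the same law as the zeros of any planar GAF
    IdentDistrib
      (fun x => pointCount
        {z : ℂ | spectrogram (noiseSTFT (whiteNoise hermiteBasis (fun k => ξ k x))) z = 0})
      (fun y => pointCount {z : ℂ | planarGAF (1 / 2) (fun k => η k y) z = 0}) P P' := by
  have hSξ := ae_summable_norm_sq_div_of_hasLaw hξ.hasLaw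
  have hζ : IsStdComplexGaussianSeq (fun k x => (-Complex.I) ^ k * ξ k x) P :=
    hξ.const_mul (by simp)
  have hF : (fun x => noiseSTFT (whiteNoise hermiteBasis (fun k => ξ k x)))
      =ᵐ[P] fun x => stftFactor * planarGAF (1 / 2) (fun k => (-Complex.I) ^ k * ξ k x) := by
    filter_upwards [hSξ] with x hx using noiseSTFT_whiteNoise hx
  have hid := identDistrib_planarGAF (1 / 2) hζ hη
  have hmul := hid.comp (u := fun f => stftFactor * f) (by fun_prop)
  have hpc := identDistrib_pointCount_zeros hid (hζ.ae_planarGAF_mem_locallyFiniteZeros _)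
  refine ⟨⟨continuous_noiseSTFT, noiseSTFT_toWeak⟩, ?_, ?_, stftFactor_ne_zero, ?_,
    ⟨_, hζ, ?_⟩, ?_⟩
  · filter_upwards [hSξ] with x hx using tendsto_truncatedNoise hermiteBasis hx
  · filter_upwards [ae_summable_norm_sq_div_of_hasLaw hη.hasLaw] with y hy
    exact ⟨differentiable_planarGAF _ hy, hasSum_planarGAF_apply _ hy⟩
  · exact (IdentDistrib.of_ae_eq (hmul.aemeasurable_fst.congr hF.symm) hF).trans hmul
  · filter_upwards [hF] with x hx
    exact ⟨hx, by rw [hx, setOf_spectrogram_stftFactor_mul_eq_zero]⟩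
  · have hZ := hF.fun_comp fun f => pointCount {z : ℂ | spectrogram f z = 0}
    simp only [Function.comp_def, setOf_spectrogram_stftFactor_mul_eq_zero] at hZ
    exact (IdentDistrib.of_ae_eq (hpc.aemeasurable_fst.congr hZ.symm) hZ).trans hpc
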